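/- **Setting.** Let $\nu\ge 2$ and $N\ge 1$ be integers, and let $\mathcal R_N$ be the tiling of $[0,1]^\nu$ into $N^\nu$ subcubes of side $1/N$. Write $c(\kappa)$ for the center of a subcube $\kappa$. A permutation $P$ of the subcubes is identified with the map $P:[0,1]^\nu\to[0,1]^\nu$ with $P(x)=x+c(P(\kappa))-c(\kappa)$ for $x\in\operatorname{int}(\kappa)$, $\kappa\in\mathcal R_N$ (and $P(x)=x$ for $x$ in no $\operatorname{int}(\kappa)$); let $\mathcal D_N$ be the group of these permutations, and $\|P-Q\|_2$ the norm of $P-Q$ in $L^2([0,1]^\nu;\mathbb R^\nu)$. An *array* $A=[\kappa_1,\dots,\kappa_{\ell(A)}]$ of length $\ell(A)\ge 2$ consists of consecutive subcubes of $\mathcal R_N$ along a line in a coordinate direction. An *elementary movement* $Z\in\mathcal D_N$ is given by finitely many pairwise disjoint arrays $A_1,\dots,A_m$ and, in each array $A_i=[\kappa_1,\dots,\kappa_{\ell(A_i)}]$, by positions $p_1<p_2<\dots<p_{2h(i)}$ (where $0\le 2h(i)\le \ell(A_i)$): $Z$ exchanges $\kappa_{p_j}$ and $\kappa_{p_{2h(i)-j+1}}$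 for all $i$ and all $1\le j\le h(i)$, and it fixes all other subcubes. Its cost is $$L(Z)=\max_i \ell(A_i)\; N^{-1-\frac{\nu}{2}}\sqrt{\sum_{i=1}^m h(i)}$$ (computed from the given arrays and positions; the cost is $0$ if $m=0$). A *discrete flow* is a finite, possibly empty, sequence $Z_1,\dots,Z_T$ of elementary movements; it connects $P$ to $Q$ if $Z_T\circ\dots\circ Z_1\circ P=Q$. Finally, for $P,Q\in\mathcal D_N$, $$\mathrm{dist}_{\mathcal D_N}(P,Q)=\min\Big\{\sum_{j=1}^T L(Z_j)\;:\; Z_1,\dots,Z_T \text{ connects } P \text{ to } Q\Big\}.$$ **Theorem (Improved Shnirelman's discrete inequality).** For every $\nu\ge 3$ there are a constant $C=C(\nu)>0$ and an exponent $\alpha=\alpha(\nu)\ge\frac{1}{1+\nu}$ such that, for every $N\ge 1$ and all permutations $P,Q\in\mathcal D_N$ of the tiling $\mathcal R_N$ of $[0,1]^\nu$, $$\mathrm{dist}_{\mathcal D_N}(P,Q)\le C\,\|P-Q\|_2^{\alpha}.$$ For $\nu=2$ the same holds, for some constant $C>0$, with some $\alpha\ge\frac27$. -/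

import Mathlib

open scoped ENNReal

noncomputable section

namespace Shnirelman

/-- The subcubes of the tiling of `[0,1]^ν` into `N ^ ν` cubes of side `1 / N`; the multi-index `κ`
stands for the cube `∏ₖ [κₖ / N, (κₖ + 1) / N]`. -/
abbrev Cell (ν N : ℕ) : Type := Fin ν → Fin N

/-- The interior of the subcube with index `κ`. -/
def openCube {ν N : ℕ} (κ : Cell ν N) : Set (EuclideanSpace ℝ (Fin ν)) :=
  {x | ∀ k, ((κ k : ℕ) : ℝ) / N < x k ∧ x k < (((κ k : ℕ) : ℝ) + 1) / N}

/-- The center of the subcube with index `κ`. -/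
def center {ν N : ℕ} (κ : Cell ν N) : EuclideanSpace ℝ (Fin ν) :=
  WithLp.toLp 2 fun k => (((κ k : ℕ) : ℝ) + 1 / 2) / N

/-- The closed unit cube `[0,1]^ν`. -/
def unitCube (ν : ℕ) : Set (EuclideanSpace ℝ (Fin ν)) :=
  {x | ∀ k, 0 ≤ x k ∧ x k ≤ 1}

/-- The group of permutations of the subcubes of the tiling. Its elements act on `[0,1]^ν` by
translating the subcubes, see `toMap`. -/
abbrev CubePerm (ν N : ℕ) : Type := Equiv.Perm (Cell ν N)

open Classical in
/-- The map of `[0,1]^ν` given by a permutation of the subcubes: it translates the interior of each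
subcube `κ` by `center (P κ) - center κ` (the interiors are pairwise disjoint, so that at most one
term of the sum is non-zero), and it fixes all other points. -/
def toMap {ν N : ℕ} (P : CubePerm ν N) (x : EuclideanSpace ℝ (Fin ν)) :
    EuclideanSpace ℝ (Fin ν) :=
  x + ∑ κ : Cell ν N, if x ∈ openCube κ then center (P κ) - center κ else 0

theorem openCube_unique {ν N : ℕ} {κ κ' : Cell ν N} {x : EuclideanSpace ℝ (Fin ν)}
    (h : x ∈ openCube κ) (h' : x ∈ openCube κ') : κ = κ' := by
  funext k
  have hN : (0 : ℝ) < N := by exact_mod_cast (κ k).pos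
  obtain ⟨h1, h2⟩ := h k
  obtain ⟨h3, h4⟩ := h' k
  have h5 : ((κ k : ℕ) : ℝ) < ((κ' k : ℕ) : ℝ) + 1 :=
    (div_lt_div_iff_of_pos_right hN).1 (h1.trans h4)
  have h6 : ((κ' k : ℕ) : ℝ) < ((κ k : ℕ) : ℝ) + 1 :=
    (div_lt_div_iff_of_pos_right hN).1 (h3.trans h2)
  have h7 : (κ k : ℕ) < (κ' k : ℕ) + 1 := by exact_mod_cast h5
  have h8 : (κ' k : ℕ) < (κ k : ℕ) + 1 := by exact_mod_cast h6
  exact Fin.ext (by omega)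

/-- On the interior of `κ` the map is the translation taking the center of `κ` to that of `P κ`. -/
theorem toMap_of_mem {ν N : ℕ} (P : CubePerm ν N) {κ : Cell ν N}
    {x : EuclideanSpace ℝ (Fin ν)} (hx : x ∈ openCube κ) :
    toMap P x = x + (center (P κ) - center κ) := by
  unfold toMap
  rw [Finset.sum_eq_single κ]
  · rw [if_pos hx]
  · intro κ' _ hne
    exact if_neg fun h => hne (openCube_unique h hx)
  · intro h
    exact absurd (Finset.mem_univ κ) h

theorem toMap_of_notMem {ν N : ℕ} (P : CubePerm ν N) {x : EuclideanSpace ℝ (Fin ν)}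
    (hx : ∀ κ : Cell ν N, x ∉ openCube κ) : toMap P x = x := by
  simp [toMap, hx]

theorem toMap_mem {ν N : ℕ} (P : CubePerm ν N) {κ : Cell ν N}
    {x : EuclideanSpace ℝ (Fin ν)} (hx : x ∈ openCube κ) : toMap P x ∈ openCube (P κ) := by
  rw [toMap_of_mem P hx]
  intro k
  obtain ⟨h1, h2⟩ := hx k
  simp only [center, PiLp.add_apply, PiLp.sub_apply]
  rw [add_div] at h2 ⊢
  rw [add_div, add_div]
  constructor <;> linarith

/-- Composition in the group of permutations is composition of the maps of `[0,1]^ν`. -/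
theorem toMap_mul {ν N : ℕ} (P Q : CubePerm ν N) (x : EuclideanSpace ℝ (Fin ν)) :
    toMap (P * Q) x = toMap P (toMap Q x) := by
  by_cases h : ∃ κ : Cell ν N, x ∈ openCube κ
  · obtain ⟨κ, hκ⟩ := h
    rw [toMap_of_mem P (toMap_mem Q hκ), toMap_of_mem Q hκ, toMap_of_mem _ hκ,
      Equiv.Perm.mul_apply]
    abel
  · push Not at h
    rw [toMap_of_notMem _ h, toMap_of_notMem Q h, toMap_of_notMem P h]

/-- `‖P - Q‖₂`, the norm of the difference of the two maps in `L²([0,1]^ν; ℝ^ν)`. -/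
def l2Dist {ν N : ℕ} (P Q : CubePerm ν N) : ℝ≥0∞ :=
  MeasureTheory.eLpNorm (fun x => toMap P x - toMap Q x) 2
    (MeasureTheory.volume.restrict (unitCube ν))

/-- An array: at least two consecutive subcubes along a line in the coordinate direction `dir`. -/
structure CubeArray (ν N : ℕ) where
  /-- the coordinate direction of the array -/
  dir : Fin ν
  /-- the first subcube of the array -/
  first : Cell ν N
  /-- the number of subcubes of the array -/
  len : ℕ
  two_le_len : 2 ≤ len
  fits : (first dir : ℕ) + len ≤ N

/-- The subcubes of an array `[κ₀, κ₁, …]`, in order. -/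
def CubeArray.cell {ν N : ℕ} (A : CubeArray ν N) (t : Fin A.len) : Cell ν N :=
  Function.update A.first A.dir
    ⟨(A.first A.dir : ℕ) + t, lt_of_lt_of_le (Nat.add_lt_add_left t.isLt _) A.fits⟩

/-- An elementary movement: in finitely many pairwise disjoint arrays, and in each array for an
increasing list `i₁ < i₂ < … < i₂ₕ` of positions, the subcubes at the positions `iⱼ` and
`i₍₂ₕ₋ⱼ₊₁₎` are exchanged; all other subcubes are fixed. -/
structure ElementaryMovement (ν N : ℕ) where
  /-- the number of arrays -/
  numArrays : ℕ
  /-- the arrays -/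
  arr : Fin numArrays → CubeArray ν N
  disjoint : ∀ i i', i ≠ i' → ∀ s t, (arr i).cell s ≠ (arr i').cell t
  /-- the number `h i` of couples of subcubes that are swapped in the `i`-th array -/
  couples : Fin numArrays → ℕ
  /-- the positions in the `i`-th array of the subcubes that are swapped -/
  pos : ∀ i, Fin (2 * couples i) → Fin (arr i).len
  pos_strictMono : ∀ i, StrictMono (pos i)
  /-- the permutation of the subcubes that is performed -/
  perm : CubePerm ν N
  perm_swap : ∀ i j, perm ((arr i).cell (pos i j)) = (arr i).cell (pos i j.rev)
  perm_fix : ∀ κ, (∀ i j, κ ≠ (arr i).cell (pos i j)) → perm κ = κ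

/-- The cost `maxᵢ ℓ(Aᵢ) * N ^ (-1 - ν/2) * √(∑ᵢ h(i))` of an elementary movement. -/
def ElementaryMovement.cost {ν N : ℕ} (Z : ElementaryMovement ν N) : ℝ :=
  ((Finset.univ.sup fun i => (Z.arr i).len : ℕ) : ℝ) * (N : ℝ) ^ (-1 - (ν : ℝ) / 2) *
    √((∑ i, Z.couples i : ℕ) : ℝ)

/-- A discrete flow: a finite sequence `Z₁, …, Z_T` of elementary movements. -/
abbrev DiscreteFlow (ν N : ℕ) : Type := List (ElementaryMovement ν N)

/-- The flow `Z₁, …, Z_T` connects `P` to `Q` if `Z_T ∘ ⋯ ∘ Z₁ ∘ P = Q`. -/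
def DiscreteFlow.Connects {ν N : ℕ} (F : DiscreteFlow ν N) (P Q : CubePerm ν N) : Prop :=
  F.foldl (fun R Z => Z.perm * R) P = Q

/-- The length of a discrete flow: the sum of the costs of its elementary movements. -/
def DiscreteFlow.totalCost {ν N : ℕ} (F : DiscreteFlow ν N) : ℝ :=
  (List.map ElementaryMovement.cost F).sum

/-- The discrete distance: the least length of a discrete flow that connects `P` to `Q`
(and `∞` if there were none). -/
def discreteDist {ν N : ℕ} (P Q : CubePerm ν N) : ℝ≥0∞ :=
  ⨅ (F : DiscreteFlow ν N) (_ : F.Connects P Q), ENNReal.ofReal F.totalCost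

end Shnirelman

end

/-! The exponent `1/3` works in every dimension, and `1/3` is at least `1/(1+ν)` for `ν ≥ 3` and at
least `2/7`. Write `w = N ^ (-1 - ν/2)`.

The main estimate (`exists_realizable_of_blk`): a permutation that moves at most `m` subcubes, each
inside its block of side `2 ^ j`, costs at most a constant times `(2 ^ j - 1) * w * √m`. It rests on
three reductions. (1) A permutation along one direction is sorted by bisection: one movement takes
every subcube to the correct half of its segment, and the segments are then halved. Array lengths
form a geometric series (`realizable_of_segment`). (2) Every permutation is a product of two
involutions with the same invariant blocks. (3) For an involution, the coordinates are removed one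
at a time. Conjugating by a permutation along direction `k` gives both members of each exchanged
pair the same `k`-th coordinate, so one coordinate fewer moves. A greedy colouring chooses these
coordinates without collisions, in two batches.

Let `D` be the `L²` distance and `y = D ^ (1/3)`. Use blocks of side about `y * N`. Averaging over
shifts of the block grid yields one for which at most about `N ^ ν * y ^ 2` subcubes change block.
These are treated in the whole cube, at cost about `N * w * √(N ^ ν * y ^ 2) = y`; what remains
preserves blocks and costs about `y * N * w * √(N ^ ν) = y`. -/

noncomputable section

namespace Shnirelman

variable {ν N : ℕ}

/-! ### Realizable permutations -/

/-- The permutation `σ` is reached from the identity by a discrete flow of length at most `c`. -/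
def Realizable (σ : CubePerm ν N) (c : ℝ) : Prop :=
  ∃ F : DiscreteFlow ν N, F.Connects 1 σ ∧ F.totalCost ≤ c

theorem foldl_perm (F : DiscreteFlow ν N) (P : CubePerm ν N) :
    F.foldl (fun R Z => Z.perm * R) P = F.foldl (fun R Z => Z.perm * R) 1 * P := by
  induction F generalizing P with
  | nil => simp
  | cons Z F ih =>
    simp only [List.foldl_cons]
    rw [ih (Z.perm * P), ih (Z.perm * 1)]
    simp [mul_assoc]

theorem Realizable.one {c : ℝ} (hc : 0 ≤ c) : Realizable (1 : CubePerm ν N) c :=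
  ⟨[], by simp [DiscreteFlow.Connects], by simpa [DiscreteFlow.totalCost] using hc⟩

theorem Realizable.mono {σ : CubePerm ν N} {c d : ℝ} (h : Realizable σ c) (hcd : c ≤ d) :
    Realizable σ d := by
  obtain ⟨F, hF, hc⟩ := h
  exact ⟨F, hF, hc.trans hcd⟩

theorem Realizable.mul {σ τ : CubePerm ν N} {c d : ℝ} (hτ : Realizable τ d)
    (hσ : Realizable σ c) : Realizable (τ * σ) (d + c) := by
  obtain ⟨F, hF, hFc⟩ := hσ
  obtain ⟨G, hG, hGc⟩ := hτ
  refine ⟨F ++ G, ?_, ?_⟩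
  · unfold DiscreteFlow.Connects at *
    rw [List.foldl_append, hF, foldl_perm, hG]
  · unfold DiscreteFlow.totalCost at *
    rw [List.map_append, List.sum_append]
    linarith

theorem realizable_movement (Z : ElementaryMovement ν N) : Realizable Z.perm Z.cost :=
  ⟨[Z], by simp [DiscreteFlow.Connects], by simp [DiscreteFlow.totalCost]⟩

/-- Flows act by multiplication on the left, so only `Q * P⁻¹` matters. -/
theorem discreteDist_le {P Q : CubePerm ν N} {c : ℝ} (h : Realizable (Q * P⁻¹) c) :
    discreteDist P Q ≤ ENNReal.ofReal c := by
  obtain ⟨F, hF, hc⟩ := h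
  refine (iInf₂_le F ?_).trans (ENNReal.ofReal_le_ofReal hc)
  unfold DiscreteFlow.Connects at *
  rw [foldl_perm, hF]
  simp

/-! ### Dyadic blocks -/

/-- The dyadic block of generation `j` that contains the coordinate `t`, after a shift by `s`. -/
def blk (s j : ℕ) (t : Fin N) : ℕ := ((t : ℕ) + s) / 2 ^ j

/-- The segment in direction `k`, with blocks of generation `j`, that contains a subcube. -/
def segment (k : Fin ν) (s j : ℕ) (κ : Cell ν N) : Fin ν → ℕ :=
  Function.update (fun i => (κ i : ℕ)) k (blk s j (κ k))

theorem segment_eq_iff {k : Fin ν} {s j : ℕ} {κ κ' : Cell ν N} :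
    segment k s j κ = segment k s j κ' ↔
      (∀ i, i ≠ k → κ i = κ' i) ∧ blk s j (κ k) = blk s j (κ' k) := by
  constructor
  · intro h
    refine ⟨fun i hi => ?_, ?_⟩
    · have := congrFun h i
      simp only [segment, Function.update_of_ne hi] at this
      exact Fin.ext this
    · have := congrFun h k
      simpa [segment] using this
  · rintro ⟨h1, h2⟩
    funext i
    by_cases hi : i = k
    · subst hi
      simpa [segment] using h2
    · simp [segment, Function.update_of_ne hi, h1 i hi]

theorem blk_zero_left (s : ℕ) (t : Fin N) : blk s 0 t = t + s := by simp [blk]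

theorem blk_succ (s j : ℕ) (t : Fin N) : blk s (j + 1) t = blk s j t / 2 := by
  simp [blk, pow_succ, Nat.div_div_eq_div_mul]

theorem blk_mono (s j : ℕ) : Monotone (blk s j : Fin N → ℕ) := fun _ _ h =>
  Nat.div_le_div_right (Nat.add_le_add_right h s)

theorem lt_add_of_blk_eq {s j : ℕ} {t u : Fin N} (h : blk s j t = blk s j u) :
    (u : ℕ) < t + 2 ^ j := by
  unfold blk at h
  have hp : 0 < 2 ^ j := by positivity
  have h1 := Nat.div_add_mod ((t : ℕ) + s) (2 ^ j)
  have h2 := Nat.div_add_mod ((u : ℕ) + s) (2 ^ j)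
  have h3 := Nat.mod_lt ((u : ℕ) + s) hp
  rw [h] at h1
  omega

theorem eq_of_segment_zero {k : Fin ν} {s : ℕ} {κ κ' : Cell ν N}
    (h : segment k s 0 κ = segment k s 0 κ') : κ = κ' := by
  rw [segment_eq_iff] at h
  funext i
  by_cases hi : i = k
  · subst hi
    have := h.2
    simp only [blk_zero_left] at this
    exact Fin.ext (by omega)
  · exact h.1 i hi

theorem update_eq_of_segment_eq {k : Fin ν} {s j : ℕ} {κ κ' : Cell ν N}
    (h : segment k s j κ = segment k s j κ') : Function.update κ k (κ' k) = κ' := by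
  rw [segment_eq_iff] at h
  funext i
  by_cases hi : i = k
  · subst hi; simp
  · simp [Function.update_of_ne hi, h.1 i hi]

theorem segment_update {k : Fin ν} {s j : ℕ} {κ : Cell ν N} {t : Fin N}
    (h : blk s j t = blk s j (κ k)) : segment k s j (Function.update κ k t) = segment k s j κ := by
  rw [segment_eq_iff]
  exact ⟨fun i hi => by simp [Function.update_of_ne hi], by simpa using h⟩

/-! ### One-dimensional exchanges -/

theorem mem_iff_lt_card_of_isLowerSet {n : ℕ} {J : Finset (Fin n)}
    (hJ : ∀ i ∈ J, ∀ i', i' ≤ i → i' ∈ J) (i : Fin n) : i ∈ J ↔ (i : ℕ) < J.card := by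
  constructor
  · intro hi
    have : Finset.Iic i ⊆ J := fun x hx => hJ i hi x (Finset.mem_Iic.1 hx)
    have := Finset.card_le_card this
    rw [Fin.card_Iic] at this
    omega
  · intro hi
    by_contra hn
    have : J ⊆ Finset.Iio i := fun x hx => by
      rw [Finset.mem_Iio]
      by_contra hx'
      exact hn (hJ x hx i (not_lt.1 hx'))
    have := Finset.card_le_card this
    rw [Fin.card_Iio] at this
    omega

/-- The positions in the block `q` of generation `j + 1` that `p` moves to the other half. -/
def misplaced (p : Equiv.Perm (Fin N)) (s j q : ℕ) : Finset (Fin N) :=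
  Finset.univ.filter fun t => blk s (j + 1) t = q ∧ blk s j (p t) ≠ blk s j t

/-- As `p` is a bijection of the block, as many positions leave the left half as enter it. This
needs no equality of the two halves, which the ends of `Fin N` may truncate. -/
theorem card_misplaced_left (p : Equiv.Perm (Fin N)) {s j : ℕ} (q : ℕ)
    (hp : ∀ t, blk s (j + 1) (p t) = blk s (j + 1) t) :
    (misplaced p s j q).card =
      2 * ((misplaced p s j q).filter fun t => blk s j t = 2 * q).card := by
  classical
  set L : Finset (Fin N) := Finset.univ.filter fun t => blk s j t = 2 * q
  set L' : Finset (Fin N) := Finset.univ.filter fun t => blk s j (p t) = 2 * q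
  have hcard : L.card = L'.card := by
    symm
    refine Finset.card_bij (fun t _ => p t) ?_ ?_ ?_
    · intro t ht; simpa [L, L'] using ht
    · intro a _ b _ h; exact p.injective h
    · intro b hb; exact ⟨p.symm b, by simpa [L, L'] using hb, by simp⟩
  have h1 : (misplaced p s j q).filter (fun t => blk s j t = 2 * q) = L \ L' := by
    ext t
    have := hp t
    simp only [blk_succ] at this
    simp only [misplaced, L, L', Finset.mem_filter, Finset.mem_univ, true_and, Finset.mem_sdiff,
      blk_succ]
    omega
  have h2 : (misplaced p s j q).filter (fun t => ¬ blk s j t = 2 * q) = L' \ L := by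
    ext t
    have := hp t
    simp only [blk_succ] at this
    simp only [misplaced, L, L', Finset.mem_filter, Finset.mem_univ, true_and, Finset.mem_sdiff,
      blk_succ]
    omega
  have h3 := Finset.card_filter_add_card_filter_not (s := misplaced p s j q)
    (fun t => blk s j t = 2 * q)
  rw [h1, h2] at h3
  rw [h1, ← h3]
  have := Finset.card_sdiff_add_card_inter L L'
  have := Finset.card_sdiff_add_card_inter L' L
  rw [Finset.inter_comm] at this
  omega

/-- Reversing the order of the misplaced positions of a block exchanges its halves. -/
theorem blk_orderEmbOfFin_rev_ne (p : Equiv.Perm (Fin N)) {s j : ℕ} (q : ℕ)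
    (hp : ∀ t, blk s (j + 1) (p t) = blk s (j + 1) t) {h : ℕ}
    (hS : (misplaced p s j q).card = 2 * h) (i : Fin (2 * h)) :
    blk s j ((misplaced p s j q).orderEmbOfFin hS i.rev) ≠
      blk s j ((misplaced p s j q).orderEmbOfFin hS i) := by
  classical
  set S := misplaced p s j q with hSdef
  set e := S.orderEmbOfFin hS
  set J : Finset (Fin (2 * h)) := Finset.univ.filter fun i => blk s j (e i) = 2 * q with hJ
  have he : ∀ i, blk s j (e i) / 2 = q := fun i => by
    have : e i ∈ S := Finset.orderEmbOfFin_mem _ _ _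
    simp only [hSdef, misplaced, Finset.mem_filter, blk_succ] at this
    exact this.2.1
  have hlow : ∀ i ∈ J, ∀ i', i' ≤ i → i' ∈ J := by
    intro i hi i' hii
    simp only [hJ, Finset.mem_filter, Finset.mem_univ, true_and] at hi ⊢
    have := blk_mono (N := N) s j (e.monotone hii)
    have := he i'
    omega
  have hcard : J.card = h := by
    have h1 := card_misplaced_left p q hp
    have h2 : (S.filter fun t => blk s j t = 2 * q) = J.map e.toEmbedding := by
      ext t
      simp only [Finset.mem_filter, Finset.mem_map, hJ, Finset.mem_univ, true_and]
      constructor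
      · rintro ⟨ht, hb⟩
        have : t ∈ Set.range e := by rw [Finset.range_orderEmbOfFin]; exact ht
        obtain ⟨i, rfl⟩ := this
        exact ⟨i, hb, rfl⟩
      · rintro ⟨i, hi, rfl⟩
        exact ⟨Finset.orderEmbOfFin_mem _ _ _, hi⟩
    rw [← hSdef, h2, Finset.card_map, hS] at h1
    omega
  -- The left half precedes the right one, so exactly the first `h` of the `2 * h` misplaced
  -- positions lie in it, and reversal exchanges the two groups.
  have key : ∀ i : Fin (2 * h), blk s j (e i) = 2 * q ↔ (i : ℕ) < h := fun i => by
    have := mem_iff_lt_card_of_isLowerSet hlow i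
    rw [hcard] at this
    simpa [hJ] using this
  have k1 := key i
  have k2 := key i.rev
  rw [Fin.val_rev] at k2
  have hi := i.isLt
  intro heq
  rw [heq] at k2
  omega

/-! ### Elementary movements inside segments -/

/-- A non-empty set of positions of even cardinality on a line lies in an array. -/
theorem exists_array (k : Fin ν) (a : Cell ν N) (S : Finset (Fin N)) {h L : ℕ} (hh : h ≠ 0)
    (hS : S.card = 2 * h) (hL : ∀ t ∈ S, ∀ u ∈ S, (u : ℕ) < t + L) :
    ∃ (A : CubeArray ν N) (pos : Fin (2 * h) → Fin A.len), StrictMono pos ∧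
      (∀ j, A.cell (pos j) = Function.update a k (S.orderEmbOfFin hS j)) ∧ A.len ≤ L ∧
      ∀ t, ∃ u, A.cell t = Function.update a k u ∧ ∃ lo ∈ S, ∃ hi ∈ S, lo ≤ u ∧ u ≤ hi := by
  have hne : S.Nonempty := Finset.card_pos.1 (by omega)
  set lo := S.min' hne
  set hi := S.max' hne
  have hlo : lo ∈ S := S.min'_mem hne
  have hhi : hi ∈ S := S.max'_mem hne
  have hlt : lo < hi := S.min'_lt_max'_of_card (by omega)
  have hlt' : (lo : ℕ) < hi := hlt
  have hle : ∀ t ∈ S, (lo : ℕ) ≤ t ∧ (t : ℕ) ≤ hi := fun t ht =>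
    ⟨S.min'_le t ht, S.le_max' t ht⟩
  -- The array spans exactly from the least to the greatest selected position; `h ≠ 0` makes these
  -- distinct, hence the length at least 2.
  let A : CubeArray ν N :=
    { dir := k
      first := Function.update a k lo
      len := hi - lo + 1
      two_le_len := by omega
      fits := by
        have := hi.isLt
        simp only [Function.update_self]
        omega }
  have hcell : ∀ (t : Fin A.len) (u : Fin N), (u : ℕ) = lo + t →
      A.cell t = Function.update a k u := by
    intro t u hu
    simp only [CubeArray.cell, A, Function.update_idem, Function.update_self]
    congr 1
    exact Fin.ext hu.symm
  have hmem : ∀ j, S.orderEmbOfFin hS j ∈ S := fun j => Finset.orderEmbOfFin_mem _ _ _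
  refine ⟨A, fun j => ⟨(S.orderEmbOfFin hS j : ℕ) - lo, ?_⟩, ?_, ?_, ?_, ?_⟩
  · have := hle _ (hmem j)
    simp only [A]
    omega
  · intro j j' hj
    have h1 : ((S.orderEmbOfFin hS j : Fin N) : ℕ) < S.orderEmbOfFin hS j' :=
      (S.orderEmbOfFin hS).strictMono hj
    have h2 := hle _ (hmem j)
    have h3 := hle _ (hmem j')
    show (S.orderEmbOfFin hS j : ℕ) - lo < (S.orderEmbOfFin hS j' : ℕ) - lo
    omega
  · intro j
    refine hcell _ _ ?_
    have h2 := hle _ (hmem j)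
    simp only
    omega
  · have := hL lo hlo hi hhi
    simp only [A]
    omega
  · intro t
    have ht : (t : ℕ) < hi - lo + 1 := t.isLt
    have hN := hi.isLt
    refine ⟨⟨lo + t, by omega⟩, hcell _ _ rfl, lo, hlo, hi, hhi, ?_, ?_⟩
    · rw [Fin.le_def]; simp
    · rw [Fin.le_def]
      simp only
      omega

/-- A movement exists that reverses given sets of positions of even cardinality on disjoint
segments. -/
theorem exists_movement_of_family (k : Fin ν) (s j : ℕ) {n : ℕ} (a : Fin n → Cell ν N)
    (ha : Function.Injective fun i => segment k s j (a i)) (S : Fin n → Finset (Fin N))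
    (h : Fin n → ℕ) (hh : ∀ i, h i ≠ 0) (hS : ∀ i, (S i).card = 2 * h i)
    (hblk : ∀ i, ∀ t ∈ S i, blk s j t = blk s j (a i k)) :
    ∃ Z : ElementaryMovement ν N,
      (∀ i l, Z.perm (Function.update (a i) k ((S i).orderEmbOfFin (hS i) l)) =
        Function.update (a i) k ((S i).orderEmbOfFin (hS i) l.rev)) ∧
      (∀ κ, (∀ i, ∀ t ∈ S i, κ ≠ Function.update (a i) k t) → Z.perm κ = κ) ∧
      Z.cost ≤ 2 ^ j * (N : ℝ) ^ (-1 - (ν : ℝ) / 2) * √((∑ i, h i : ℕ) : ℝ) := by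
  classical
  have hL : ∀ i, ∀ t ∈ S i, ∀ u ∈ S i, (u : ℕ) < t + 2 ^ j := fun i t ht u hu =>
    lt_add_of_blk_eq ((hblk i t ht).trans (hblk i u hu).symm)
  choose A pos hpos hcell hlen hconv using fun i => exists_array k (a i) (S i) (hh i) (hS i) (hL i)
  -- Each subcube of the array lies between two selected ones, hence in the same segment. Distinct
  -- segments therefore give disjoint arrays.
  have hseg : ∀ i t, segment k s j ((A i).cell t) = segment k s j (a i) := by
    intro i t
    obtain ⟨u, hu, lo, hlo, hi, hhi, h1, h2⟩ := hconv i t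
    rw [hu]
    refine segment_update (le_antisymm ?_ ?_)
    · rw [← hblk i hi hhi]; exact blk_mono s j h2
    · rw [← hblk i lo hlo]; exact blk_mono s j h1
  let e : (Σ i : Fin n, Fin (2 * h i)) ↪ Cell ν N :=
    { toFun := fun x => (A x.1).cell (pos x.1 x.2)
      inj' := by
        rintro ⟨i, l⟩ ⟨i', l'⟩ hxy
        simp only at hxy
        have hi : i = i' := ha (by
          simp only
          rw [← hseg i (pos i l), hxy, hseg])
        subst hi
        rw [hcell, hcell] at hxy
        have := Function.update_injective _ _ hxy
        rw [(S i).orderEmbOfFin (hS i) |>.injective this] }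
  let rv : Equiv.Perm (Σ i : Fin n, Fin (2 * h i)) :=
    Equiv.Perm.sigmaCongrRight fun _ => Fin.revPerm
  have hswap : ∀ i l, (rv.viaFintypeEmbedding e) ((A i).cell (pos i l)) =
      (A i).cell (pos i l.rev) := fun i l => rv.viaFintypeEmbedding_apply_image e ⟨i, l⟩
  have hfix : ∀ κ, (∀ i l, κ ≠ (A i).cell (pos i l)) → rv.viaFintypeEmbedding e κ = κ := by
    intro κ hκ
    refine rv.viaFintypeEmbedding_apply_notMem_range e ?_
    rintro ⟨⟨i, l⟩, hx⟩
    exact hκ i l hx.symm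
  let Z : ElementaryMovement ν N :=
    { numArrays := n
      arr := A
      disjoint := by
        intro i i' hne t t' heq
        exact hne (ha (by
          simp only
          rw [← hseg i t, heq, hseg]))
      couples := h
      pos := pos
      pos_strictMono := hpos
      perm := rv.viaFintypeEmbedding e
      perm_swap := hswap
      perm_fix := hfix }
  refine ⟨Z, ?_, ?_, ?_⟩
  · intro i l
    rw [← hcell, ← hcell]
    exact hswap i l
  · intro κ hκ
    refine hfix κ fun i l => ?_
    rw [hcell]
    exact hκ i _ (Finset.orderEmbOfFin_mem _ _ _)
  · unfold ElementaryMovement.cost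
    gcongr
    have : (Finset.univ.sup fun i => (A i).len) ≤ 2 ^ j := Finset.sup_le fun i _ => hlen i
    exact_mod_cast this

theorem exists_transversal {α β : Type*} (f : α → β) (M : Finset α) :
    ∃ (n : ℕ) (a : Fin n → α), (∀ i, a i ∈ M) ∧ Function.Injective (fun i => f (a i)) ∧
      ∀ x ∈ M, ∃ i, f (a i) = f x := by
  classical
  have h : ∀ y : M.image f, ∃ x ∈ M, f x = y := fun y =>
    Finset.mem_image.1 y.2
  choose g hgM hg using h
  refine ⟨_, fun i => g ((M.image f).equivFin.symm i), fun i => hgM _, ?_, ?_⟩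
  · intro i i' hii
    simp only [hg] at hii
    exact (M.image f).equivFin.symm.injective (Subtype.ext hii)
  · intro x hx
    exact ⟨(M.image f).equivFin ⟨f x, Finset.mem_image_of_mem f hx⟩, by simp [hg]⟩

/-- A permutation along segments acts on each line as a permutation of the positions. -/
theorem exists_perm_on_line {k : Fin ν} {s j : ℕ} {π : CubePerm ν N}
    (hπ : ∀ κ, segment k s j (π κ) = segment k s j κ) (a : Cell ν N) :
    ∃ p : Equiv.Perm (Fin N), (∀ t, π (Function.update a k t) = Function.update a k (p t)) ∧
      ∀ t, blk s j (p t) = blk s j t := by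
  have h1 : ∀ t, π (Function.update a k t) =
      Function.update a k (π (Function.update a k t) k) := by
    intro t
    have := update_eq_of_segment_eq (hπ (Function.update a k t)).symm
    rw [Function.update_idem] at this
    exact this.symm
  have hinj : Function.Injective fun t => π (Function.update a k t) k := by
    intro t t' htt
    simp only at htt
    have h2 : π (Function.update a k t) = π (Function.update a k t') := by
      rw [h1 t, h1 t', htt]
    exact Function.update_injective a k (π.injective h2)
  refine ⟨Equiv.ofBijective _ (Finite.injective_iff_bijective.1 hinj), fun t => h1 t, fun t => ?_⟩
  have := (segment_eq_iff.1 (hπ (Function.update a k t))).2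
  simpa using this

/-- One elementary movement takes each subcube to the half segment where `π` takes it. -/
theorem exists_movement {k : Fin ν} {s j : ℕ} {π : CubePerm ν N}
    (hπ : ∀ κ, segment k s (j + 1) (π κ) = segment k s (j + 1) κ) :
    ∃ Z : ElementaryMovement ν N, (∀ κ, π κ = κ → Z.perm κ = κ) ∧
      (∀ κ, segment k s j (Z.perm κ) = segment k s j (π κ)) ∧
      Z.cost ≤ 2 ^ (j + 1) * (N : ℝ) ^ (-1 - (ν : ℝ) / 2) * √(π.support.card : ℝ) := by
  classical
  choose p hp hpb using exists_perm_on_line hπ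
  set M : Finset (Cell ν N) :=
    Finset.univ.filter fun κ => segment k s j (π κ) ≠ segment k s j κ with hM
  have hMsupp : M ⊆ π.support := by
    intro κ hκ
    rw [Equiv.Perm.mem_support]
    intro h
    simp [hM, h] at hκ
  obtain ⟨n, a, haM, hainj, hasurj⟩ := exists_transversal (segment k s (j + 1)) M
  -- One array for each segment with a misplaced subcube; `a i` is a representative of that segment.
  let S : Fin n → Finset (Fin N) := fun i => misplaced (p (a i)) s j (blk s (j + 1) (a i k))
  have hSM : ∀ i t, t ∈ S i ↔
      Function.update (a i) k t ∈ M ∧ blk s (j + 1) t = blk s (j + 1) (a i k) := by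
    intro i t
    simp only [S, misplaced, hM, Finset.mem_filter, Finset.mem_univ, true_and, hp, ne_eq,
      segment_eq_iff, Function.update_self]
    constructor
    · rintro ⟨h1, h2⟩; exact ⟨fun h => h2 h.2, h1⟩
    · rintro ⟨h1, h2⟩
      exact ⟨h2, fun h => h1 ⟨fun l hl => by simp [Function.update_of_ne hl], h⟩⟩
  let h : Fin n → ℕ := fun i =>
    ((S i).filter fun t => blk s j t = 2 * blk s (j + 1) (a i k)).card
  have hS : ∀ i, (S i).card = 2 * h i := fun i => card_misplaced_left (p (a i)) _ (hpb (a i))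
  have haS : ∀ i, a i k ∈ S i := fun i => by
    rw [hSM]; simpa using haM i
  have hh : ∀ i, h i ≠ 0 := fun i h0 => by
    have := hS i
    rw [h0, mul_zero, Finset.card_eq_zero] at this
    have h1 := haS i
    simp [this] at h1
  have hblk : ∀ i, ∀ t ∈ S i, blk s (j + 1) t = blk s (j + 1) (a i k) :=
    fun i t ht => ((hSM i t).1 ht).2
  obtain ⟨Z, hZ1, hZ2, hZ3⟩ := exists_movement_of_family k s (j + 1) a hainj S h hh hS hblk
  have hnot : ∀ κ, κ ∉ M → Z.perm κ = κ := fun κ hκ => hZ2 κ fun i t ht heq =>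
    hκ (by rw [heq]; exact ((hSM i t).1 ht).1)
  refine ⟨Z, fun κ hκ => hnot κ fun h => ?_, fun κ => ?_, hZ3.trans ?_⟩
  · exact (Equiv.Perm.mem_support.1 (hMsupp h)) hκ
  · by_cases hκ : κ ∈ M
    · obtain ⟨i, hi⟩ := hasurj κ hκ
      have hκi : Function.update (a i) k (κ k) = κ := update_eq_of_segment_eq hi
      have hκS : κ k ∈ S i := by
        rw [hSM, hκi]
        exact ⟨hκ, (segment_eq_iff.1 hi).2.symm⟩
      have : κ k ∈ Set.range ((S i).orderEmbOfFin (hS i)) := by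
        rw [Finset.range_orderEmbOfFin]; exact hκS
      obtain ⟨l, hl⟩ := this
      have hne := blk_orderEmbOfFin_rev_ne (p (a i)) _ (hpb (a i)) (hS i) l
      have hb : blk s (j + 1) ((S i).orderEmbOfFin (hS i) l.rev) = blk s (j + 1) (κ k) :=
        (hblk i _ (Finset.orderEmbOfFin_mem _ _ _)).trans (segment_eq_iff.1 hi).2
      have hZκ := hZ1 i l
      rw [hl, hκi] at hZκ
      change blk s j ((S i).orderEmbOfFin (hS i) l.rev) ≠
        blk s j ((S i).orderEmbOfFin (hS i) l) at hne
      rw [hl] at hne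
      have hpκ := hp (a i) (κ k)
      rw [hκi] at hpκ
      have hmis : blk s j (p (a i) (κ k)) ≠ blk s j (κ k) := by
        have := hκS
        simp only [S, misplaced, Finset.mem_filter] at this
        exact this.2.2
      have hpb' := hpb (a i) (κ k)
      rw [blk_succ, blk_succ] at hb hpb'
      rw [hZκ, hpκ, segment_eq_iff]
      refine ⟨fun l hl => by simp [Function.update_of_ne hl], ?_⟩
      simp only [Function.update_self]
      omega
    · rw [hnot κ hκ]
      simp only [hM, Finset.mem_filter, Finset.mem_univ, true_and, ne_eq, not_not] at hκ
      exact hκ.symm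
  · gcongr
    have hle : ∑ i, 2 * h i ≤ M.card := by
      have : (Finset.univ.sigma S).card ≤ M.card := by
        refine Finset.card_le_card_of_injOn (fun x => Function.update (a x.1) k x.2) ?_ ?_
        · intro x hx
          exact ((hSM _ _).1 (Finset.mem_sigma.1 hx).2).1
        · rintro ⟨i, t⟩ hx ⟨i', t'⟩ hx' heq
          simp only at heq
          have h1 := ((hSM _ _).1 (Finset.mem_sigma.1 hx).2).2
          have h2 := ((hSM _ _).1 (Finset.mem_sigma.1 hx').2).2
          have hi : i = i' := hainj (by
            simp only
            rw [← segment_update h1, ← segment_update h2]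
            simp only at heq ⊢
            rw [heq])
          subst hi
          rw [Function.update_injective _ _ heq]
      simpa [Finset.card_sigma, hS] using this
    rw [← Finset.mul_sum] at hle
    have := Finset.card_le_card hMsupp
    omega

/-- A permutation along segments of generation `j` is reached by `j` elementary movements. -/
theorem realizable_of_segment (k : Fin ν) (s j : ℕ) (π : CubePerm ν N)
    (hπ : ∀ κ, segment k s j (π κ) = segment k s j κ) {m : ℕ} (hm : π.support.card ≤ m) :
    Realizable π (2 * (2 ^ j - 1) * (N : ℝ) ^ (-1 - (ν : ℝ) / 2) * √(m : ℝ)) := by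
  induction j generalizing π with
  | zero =>
    have : π = 1 := Equiv.ext fun κ => eq_of_segment_zero (hπ κ)
    rw [this]
    exact Realizable.one (by simp)
  | succ j ih =>
    obtain ⟨Z, hfix, hseg, hcost⟩ := exists_movement hπ
    have h1 : ∀ κ, segment k s j ((π * Z.perm⁻¹) κ) = segment k s j κ := by
      intro κ
      have := hseg (Z.perm⁻¹ κ)
      rw [Equiv.Perm.mul_apply, ← this]
      simp
    have h2 : (π * Z.perm⁻¹).support ⊆ π.support := by
      intro κ hκ
      rw [Equiv.Perm.mem_support] at hκ ⊢
      intro h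
      apply hκ
      have := hfix κ h
      rw [Equiv.Perm.mul_apply, Equiv.Perm.inv_eq_iff_eq.2 this.symm, h]
    have h3 := (ih _ h1 ((Finset.card_le_card h2).trans hm)).mul (realizable_movement Z)
    rw [inv_mul_cancel_right] at h3
    -- The geometric series: `2 * (2 ^ j - 1) + 2 ^ (j + 1) = 2 * (2 ^ (j + 1) - 1)`.
    refine h3.mono ?_
    have h4 : Z.cost ≤ 2 ^ (j + 1) * (N : ℝ) ^ (-1 - (ν : ℝ) / 2) * √(m : ℝ) :=
      hcost.trans (by gcongr)
    rw [pow_succ] at h4 ⊢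
    nlinarith [h4]

/-! ### Combinatorial tools -/

/-- Vertices are recoloured one by one: the colours on `nbr w` are fewer than those allowed at `w`,
so one is free. -/
theorem exists_greedy_coloring {V C : Type*} [Fintype V] (adj : V → V → Prop)
    (hsymm : ∀ u v, adj u v → adj v u) (hirr : ∀ v, ¬ adj v v) (allowed : V → Finset C)
    (nbr : V → Finset V) (hnbr : ∀ u v, adj u v → v ∈ nbr u)
    (hcard : ∀ v, (nbr v).card < (allowed v).card) :
    ∃ c : V → C, (∀ v, c v ∈ allowed v) ∧ ∀ u v, adj u v → c u ≠ c v := by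
  classical
  suffices h : ∀ T : Finset V, ∃ c : V → C, (∀ v, c v ∈ allowed v) ∧
      ∀ u ∈ T, ∀ v ∈ T, adj u v → c u ≠ c v by
    obtain ⟨c, h1, h2⟩ := h Finset.univ
    exact ⟨c, h1, fun u v => h2 u (Finset.mem_univ _) v (Finset.mem_univ _)⟩
  intro T
  induction T using Finset.induction_on with
  | empty =>
    have : ∀ v, ∃ x, x ∈ allowed v := fun v => Finset.card_pos.1 (by have := hcard v; omega)
    choose c hc using this
    exact ⟨c, hc, by simp⟩
  | insert w T hw ih =>
    obtain ⟨c, h1, h2⟩ := ih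
    obtain ⟨x, hx, hx'⟩ : ∃ x ∈ allowed w, x ∉ (nbr w).image c :=
      Finset.exists_mem_notMem_of_card_lt_card (Finset.card_image_le.trans_lt (hcard w))
    have hne : ∀ v, adj w v → x ≠ c v := fun v hv h =>
      hx' (Finset.mem_image.2 ⟨v, hnbr _ _ hv, h.symm⟩)
    refine ⟨Function.update c w x, fun v => ?_, fun u hu v hv huv => ?_⟩
    · by_cases hv : v = w
      · subst hv; simpa using hx
      · simpa [Function.update_of_ne hv] using h1 v
    · by_cases huw : u = w
      · subst huw
        have hvu : v ≠ u := fun h => hirr u (h ▸ huv)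
        simpa [Function.update_of_ne hvu] using hne v huv
      · by_cases hvw : v = w
        · subst hvw
          simpa [Function.update_of_ne huw] using (hne u (hsymm _ _ huv)).symm
        · rw [Function.update_of_ne huw, Function.update_of_ne hvw]
          exact h2 u ((Finset.mem_insert.1 hu).resolve_left huw) v
            ((Finset.mem_insert.1 hv).resolve_left hvw) huv

/-- An injective map of `A` that preserves the label `lab` extends to a permutation that preserves
the label and moves only points of `A` and of its image. -/
theorem exists_perm_extending {α β : Type*} [DecidableEq α] (lab : α → β) (f : α → α)
    (A : Finset α) (hinj : Set.InjOn f A) (hlab : ∀ x ∈ A, lab (f x) = lab x) :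
    ∃ φ : Equiv.Perm α, (∀ x ∈ A, φ x = f x) ∧ (∀ x, lab (φ x) = lab x) ∧
      ∀ x, x ∉ A → x ∉ A.image f → φ x = x := by
  induction A using Finset.induction_on with
  | empty => exact ⟨1, by simp, by simp, by simp⟩
  | insert a A ha ih =>
    obtain ⟨φ, h1, h2, h3⟩ := ih (hinj.mono (by simp)) fun x hx => hlab x (by simp [hx])
    -- The extension is corrected at `a` by a transposition of two points that both carry the label
    -- of `a`.
    have hswap : ∀ y, lab (Equiv.swap (φ a) (f a) y) = lab y := by
      intro y
      have : lab (φ a) = lab (f a) := by rw [h2, hlab a (by simp)]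
      rw [Equiv.swap_apply_def]
      split_ifs with h h'
      · rw [h, this]
      · rw [h', this]
      · rfl
    refine ⟨Equiv.swap (φ a) (f a) * φ, fun x hx => ?_, fun x => ?_, fun x hx hx' => ?_⟩
    · rcases Finset.mem_insert.1 hx with rfl | hxA
      · simp
      · have hxa : x ≠ a := fun h => ha (h ▸ hxA)
        rw [Equiv.Perm.mul_apply, Equiv.swap_apply_of_ne_of_ne, h1 x hxA]
        · exact fun h => hxa (φ.injective h)
        · rw [h1 x hxA]
          exact fun h => hxa (hinj (by simp [hxA]) (by simp) h)
    · rw [Equiv.Perm.mul_apply, hswap, h2]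
    · simp only [Finset.mem_insert, not_or, Finset.image_insert] at hx hx'
      have hφ := h3 x hx.2 hx'.2
      rw [Equiv.Perm.mul_apply, hφ, Equiv.swap_apply_of_ne_of_ne _ hx'.1]
      intro h
      exact hx.1 (φ.injective (hφ.trans h))

/-- Every permutation is the product of two involutions that preserve its cycles. -/
theorem exists_involutions_mul_eq {α : Type*} (σ : Equiv.Perm α) :
    ∃ a b : Equiv.Perm α, σ = a * b ∧ (∀ x, a (a x) = x) ∧ (∀ x, b (b x) = x) ∧
      (∀ x, σ.SameCycle x (a x)) ∧ ∀ x, σ.SameCycle x (b x) := by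
  classical
  let st := Equiv.Perm.SameCycle.setoid σ
  let r : α → α := fun x => (Quotient.mk st x).out
  have hr : ∀ x, σ.SameCycle (r x) x := fun x => Quotient.exact (Quotient.out_eq (Quotient.mk st x))
  have hrr : ∀ x y, σ.SameCycle x y → r x = r y := fun x y h => by
    simp only [r]
    rw [show Quotient.mk st x = Quotient.mk st y from Quotient.sound h]
  choose i hi using hr
  -- The reflection `σ ^ i (r) ↦ σ ^ (-i) (r)` of each cycle about its base point `r`, as in a
  -- dihedral group.
  let a : α → α := fun x => (σ ^ (-(i x))) (r x)
  have hcyc : ∀ x, σ.SameCycle x (a x) := fun x =>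
    (show σ.SameCycle (r x) x from ⟨i x, hi x⟩).symm.trans ⟨_, rfl⟩
  -- the value does not depend on the exponent
  have hval : ∀ x (n : ℤ), (σ ^ n) (r x) = x → a x = (σ ^ (-n)) (r x) := by
    intro x n hn
    simp only [a]
    have h : (σ ^ n) (r x) = (σ ^ i x) (r x) := hn.trans (hi x).symm
    apply (σ ^ (n + i x)).injective
    rw [← Equiv.Perm.mul_apply, ← Equiv.Perm.mul_apply, ← zpow_add, ← zpow_add]
    simpa using h
  have hinv : ∀ x, a (a x) = x := by
    intro x
    have h := hval (a x) (-(i x)) (by rw [← hrr _ _ (hcyc x)])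
    rw [h, neg_neg, ← hrr _ _ (hcyc x), hi]
  -- The dihedral relation `σ * a * σ = a`, which makes `a * σ` an involution.
  have hσ : ∀ x, σ (a (σ x)) = a x := by
    intro x
    have hx : r (σ x) = r x := (hrr _ _ ⟨1, by simp⟩).symm
    have h := hval (σ x) (1 + i x) (by rw [hx, zpow_add, Equiv.Perm.mul_apply, hi, zpow_one])
    rw [h, hx]
    simp only [a]
    rw [neg_add, zpow_add, Equiv.Perm.mul_apply, zpow_neg_one]
    simp
  let A : Equiv.Perm α := Function.Involutive.toPerm a hinv
  have hb : ∀ x, (A * σ) ((A * σ) x) = x := fun x => by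
    show a (σ (a (σ x))) = x
    rw [hσ, hinv]
  refine ⟨A, A * σ, ?_, hinv, hb, hcyc, fun x => ?_⟩
  · ext x
    exact (hinv (σ x)).symm
  · exact (show σ.SameCycle x (σ x) from ⟨1, by simp⟩).trans (hcyc (σ x))

/-- Picking one point in each orbit turns a colouring of points into a colouring of exchanged pairs.
-/
theorem exists_representative {α : Type*} [Finite α] (σ : Equiv.Perm α) (hσ : ∀ x, σ (σ x) = x) :
    ∃ r : α → α, (∀ x, r (σ x) = r x) ∧ ∀ x, r x = x ∨ r x = σ x := by
  classical
  obtain ⟨n, ⟨e⟩⟩ := Finite.exists_equiv_fin α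
  refine ⟨fun x => if e x ≤ e (σ x) then x else σ x, fun x => ?_, fun x => ?_⟩
  · simp only [hσ]
    split_ifs with h1 h2 h2
    · exact e.injective (le_antisymm h1 h2)
    · rfl
    · rfl
    · exact absurd (le_of_not_ge h1) h2
  · simp only
    split_ifs
    · exact Or.inl rfl
    · exact Or.inr rfl

/-- The restriction of an involution to the points that satisfy an invariant predicate. -/
theorem exists_involution_restrict {α : Type*} [DecidableEq α] [Fintype α] (σ : Equiv.Perm α)
    (hσ : ∀ x, σ (σ x) = x) (p : α → Prop) (hp : ∀ x, p (σ x) ↔ p x) :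
    ∃ τ : Equiv.Perm α, (∀ x, τ (τ x) = x) ∧ (∀ x, p x → τ x = σ x) ∧ ∀ x, ¬ p x → τ x = x := by
  classical
  have h : Function.Involutive fun x => if p x then σ x else x := by
    intro x
    by_cases hx : p x
    · simp [hx, hp, hσ]
    · simp [hx]
  exact ⟨h.toPerm, h, fun x hx => by simp [hx], fun x hx => by simp [hx]⟩

/-! ### Involutions inside blocks -/

/-- The pairs of an involution that preserves blocks are coloured by two batches and by the
coordinates in the block, so that the subcubes of a segment have different colours. -/
theorem exists_coloring (k : Fin ν) (s j : ℕ) (σ : CubePerm ν N) (hσ : ∀ κ, σ (σ κ) = κ)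
    (hblk : ∀ κ, blk s j (σ κ k) = blk s j (κ k)) :
    ∃ c : Cell ν N → Bool × Fin N, (∀ κ, c (σ κ) = c κ) ∧
      (∀ κ, blk s j (c κ).2 = blk s j (κ k)) ∧
      ∀ κ κ', κ ≠ κ' → segment k s j κ = segment k s j κ' →
        segment k s j (σ κ) ≠ segment k s j κ → c κ ≠ c κ' := by
  classical
  obtain ⟨r, hr, hr'⟩ := exists_representative σ hσ
  let seg : Cell ν N → Finset (Cell ν N) := fun κ =>
    Finset.univ.filter fun κ' => segment k s j κ' = segment k s j κ
  let allowed : Cell ν N → Finset (Bool × Fin N) := fun κ =>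
    Finset.univ ×ˢ Finset.univ.filter fun t => blk s j t = blk s j (κ k)
  have hsegcard : ∀ κ, (seg κ).card =
      (Finset.univ.filter fun t : Fin N => blk s j t = blk s j (κ k)).card := by
    intro κ
    refine Finset.card_bij (fun κ' _ => κ' k) ?_ ?_ ?_
    · intro κ' hκ'
      simp only [seg, Finset.mem_filter, Finset.mem_univ, true_and] at hκ' ⊢
      exact (segment_eq_iff.1 hκ').2
    · intro κ₁ h₁ κ₂ h₂ h
      simp only [seg, Finset.mem_filter, Finset.mem_univ, true_and] at h₁ h₂
      rw [← update_eq_of_segment_eq (h₁.trans h₂.symm), ← h, Function.update_eq_self]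
    · intro t ht
      simp only [Finset.mem_filter, Finset.mem_univ, true_and] at ht
      exact ⟨Function.update κ k t, by simpa [seg] using segment_update ht, by simp⟩
  let nbr : Cell ν N → Finset (Cell ν N) := fun κ =>
    ((seg κ).erase κ ∪ (seg (σ κ)).erase (σ κ)).image r
  let adj : Cell ν N → Cell ν N → Prop := fun κ κ' => r κ = κ ∧ r κ' = κ' ∧ κ ≠ κ' ∧
    ∃ x y, (x = κ ∨ x = σ κ) ∧ (y = κ' ∨ y = σ κ') ∧ segment k s j x = segment k s j y
  obtain ⟨c, hc1, hc2⟩ := exists_greedy_coloring adj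
    (by
      rintro u v ⟨h1, h2, h3, x, y, hx, hy, h⟩
      exact ⟨h2, h1, h3.symm, y, x, hy, hx, h.symm⟩)
    (fun v h => h.2.2.1 rfl) allowed nbr
    (by
      rintro u v ⟨h1, h2, h3, x, y, hx, hy, h⟩
      simp only [nbr, Finset.mem_image, Finset.mem_union, Finset.mem_erase]
      have hry : r y = v := by rcases hy with rfl | rfl <;> simp [hr, h2]
      refine ⟨y, ?_, hry⟩
      have hyu : r y ≠ r u := by rw [hry, h1]; exact h3.symm
      rcases hx with rfl | rfl
      · exact Or.inl ⟨fun h' => hyu (by rw [h']), by simp [seg, h]⟩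
      · exact Or.inr ⟨fun h' => hyu (by rw [h', hr]), by simp [seg, h]⟩)
    -- With `l` subcubes per segment, a pair meets at most two segments and so has at most `2 * (l -
    -- 1)` neighbours, against `2 * l` colours: two batches times `l` coordinates.
    (by
      intro v
      have h1 : ((seg v).erase v).card = (seg v).card - 1 :=
        Finset.card_erase_of_mem (by simp [seg])
      have h2 : ((seg (σ v)).erase (σ v)).card = (seg (σ v)).card - 1 :=
        Finset.card_erase_of_mem (by simp [seg])
      have h3 : 0 < (seg v).card := Finset.card_pos.2 ⟨v, by simp [seg]⟩
      have h4 : (seg (σ v)).card = (seg v).card := by rw [hsegcard, hsegcard, hblk]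
      have h5 : (allowed v).card = 2 * (seg v).card := by
        simp [allowed, hsegcard, Finset.card_product]
      have h6 : (nbr v).card ≤ _ := Finset.card_image_le
      have h7 := Finset.card_union_le ((seg v).erase v) ((seg (σ v)).erase (σ v))
      omega)
  refine ⟨fun κ => c (r κ), fun κ => by simp only [hr], fun κ => ?_, fun κ κ' hne hseg hσseg => ?_⟩
  · have h := hc1 (r κ)
    simp only [allowed, Finset.mem_product, Finset.mem_univ, true_and, Finset.mem_filter] at h
    rw [h]
    rcases hr' κ with h' | h' <;> rw [h']
    exact hblk κ
  · have hrr : ∀ x, r (r x) = r x := fun x => by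
      rcases hr' x with h | h
      · rw [h, h]
      · rw [h, hr, h]
    have hx : ∀ x, x = r x ∨ x = σ (r x) := fun x => by
      rcases hr' x with h | h
      · exact Or.inl h.symm
      · exact Or.inr (by rw [h, hσ])
    refine hc2 _ _ ⟨hrr _, hrr _, fun h => ?_, κ, κ', hx κ, hx κ', hseg⟩
    -- The two members of a pair share a colour, which is harmless only because they lie in
    -- different segments.
    have : κ' = κ ∨ κ' = σ κ := by
      rcases hr' κ with h1 | h1 <;> rcases hr' κ' with h2 | h2
      · exact absurd (by rw [← h1, ← h2, h]) hne
      · right; rw [← h1, h, h2, hσ]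
      · right; rw [← h1, h, h2]
      · exact absurd (σ.injective (by rw [← h1, ← h2, h])) hne
    rcases this with h' | h'
    · exact hne h'.symm
    · exact hσseg (by rw [← h', hseg])

/-- An involution is reached by conjugation with a permutation along segments that moves the
subcubes `κ` of a batch to the coordinate `z κ = z (σ κ)`. -/
theorem realizable_of_batch (k : Fin ν) (s j : ℕ) (τ : CubePerm ν N) {m : ℕ} {c : ℝ}
    (hτ : ∀ κ, τ (τ κ) = κ) (hblk : ∀ κ i, blk s j (τ κ i) = blk s j (κ i))
    (A : Finset (Cell ν N)) (hA : A.card ≤ m) (hτA : ∀ κ, κ ∉ A → τ κ = κ)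
    (hAτ : ∀ κ ∈ A, τ κ ∈ A)
    (z : Cell ν N → Fin N) (hz : ∀ κ ∈ A, z (τ κ) = z κ)
    (hzblk : ∀ κ ∈ A, blk s j (z κ) = blk s j (κ k))
    (hinj : ∀ κ ∈ A, ∀ κ' ∈ A, segment k s j κ = segment k s j κ' → z κ = z κ' → κ = κ')
    (hrec : ∀ τ' : CubePerm ν N, (∀ κ, τ' (τ' κ) = κ) →
      (∀ κ i, blk s j (τ' κ i) = blk s j (κ i)) → (∀ κ, τ' κ k = κ k) →
      (∀ i, i ≠ k → (∀ κ, τ κ i = κ i) → ∀ κ, τ' κ i = κ i) → τ'.support.card ≤ m →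
      Realizable τ' c) :
    Realizable τ (8 * ((2 ^ j - 1) * (N : ℝ) ^ (-1 - (ν : ℝ) / 2) * √(m : ℝ)) + c) := by
  classical
  have hseg : ∀ κ ∈ A, segment k s j (Function.update κ k (z κ)) = segment k s j κ :=
    fun κ hκ => segment_update (hzblk κ hκ)
  obtain ⟨φ, hφA, hφseg, hφfix⟩ := exists_perm_extending (segment k s j)
    (fun κ => Function.update κ k (z κ)) A
    (by
      intro κ hκ κ' hκ' h
      simp only at h
      refine hinj κ hκ κ' hκ' ?_ ?_
      · rw [← hseg κ hκ, ← hseg κ' hκ', h]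
      · have := congrFun h k
        simpa using this)
    hseg
  have hφsupp : φ.support.card ≤ 2 * m := by
    have h1 : φ.support ⊆ A ∪ A.image fun κ => Function.update κ k (z κ) := by
      intro κ hκ
      by_contra h
      rw [Finset.mem_union, not_or] at h
      exact Equiv.Perm.mem_support.1 hκ (hφfix κ h.1 h.2)
    have h2 := Finset.card_le_card h1
    have h3 := Finset.card_union_le A (A.image fun κ => Function.update κ k (z κ))
    have h4 : (A.image fun κ => Function.update κ k (z κ)).card ≤ A.card := Finset.card_image_le
    omega
  have hφ_blk : ∀ κ i, blk s j (φ κ i) = blk s j (κ i) := by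
    intro κ i
    have := segment_eq_iff.1 (hφseg κ)
    by_cases hi : i = k
    · rw [hi, this.2]
    · rw [this.1 i hi]
  have hφinv : ∀ κ, segment k s j (φ⁻¹ κ) = segment k s j κ := fun κ => by
    have := hφseg (φ⁻¹ κ)
    simpa using this.symm
  have hR1 := realizable_of_segment k s j φ hφseg hφsupp
  have hR2 := realizable_of_segment k s j φ⁻¹ hφinv (m := 2 * m) (by
    rwa [Equiv.Perm.support_inv])
  have hsurj : ∀ κ, ∃ κ₀, φ κ₀ = κ := φ.surjective
  have happ : ∀ κ, (φ * τ * φ⁻¹) (φ κ) = φ (τ κ) := fun κ => by simp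
  -- After `φ`, both members of a pair have the `k`-th coordinate `z κ`, so the conjugate no longer
  -- moves that coordinate.
  have hR3 : Realizable (φ * τ * φ⁻¹) c := by
    refine hrec _ (fun κ => ?_) (fun κ i => ?_) (fun κ => ?_) (fun i hi hτi κ => ?_) ?_
    · obtain ⟨κ, rfl⟩ := hsurj κ
      rw [happ, happ, hτ]
    · obtain ⟨κ, rfl⟩ := hsurj κ
      rw [happ, hφ_blk, hφ_blk, hblk]
    · obtain ⟨κ, rfl⟩ := hsurj κ
      rw [happ]
      by_cases hκ : κ ∈ A
      · rw [hφA _ (hAτ κ hκ), hφA _ hκ]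
        simp [hz κ hκ]
      · rw [hτA κ hκ]
    · obtain ⟨κ, rfl⟩ := hsurj κ
      rw [happ, (segment_eq_iff.1 (hφseg _)).1 i hi, hτi,
        (segment_eq_iff.1 (hφseg _)).1 i hi]
    · rw [Equiv.Perm.card_support_conj]
      refine (Finset.card_le_card fun κ hκ => ?_).trans hA
      by_contra h
      exact Equiv.Perm.mem_support.1 hκ (hτA κ h)
  have hR := hR2.mul (hR3.mul hR1)
  have heq : φ⁻¹ * (φ * τ * φ⁻¹ * φ) = τ := by group
  rw [heq] at hR
  refine hR.mono ?_
  -- `φ` may move both `A` and its image, hence `2 * m`. Each of `φ` and `φ⁻¹` then costs at most 4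
  -- units, which gives the 8.
  have hs : √((2 * m : ℕ) : ℝ) ≤ 2 * √(m : ℝ) := by
    rw [Real.sqrt_le_left (by positivity), mul_pow, Real.sq_sqrt (by positivity)]
    push_cast
    nlinarith [(Nat.cast_nonneg m : (0 : ℝ) ≤ m)]
  have hj : (0 : ℝ) ≤ 2 ^ j - 1 := sub_nonneg.2 (one_le_pow₀ (by norm_num))
  have hu : (0 : ℝ) ≤ (2 ^ j - 1) * (N : ℝ) ^ (-1 - (ν : ℝ) / 2) :=
    mul_nonneg hj (Real.rpow_nonneg (Nat.cast_nonneg N) _)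
  have := mul_le_mul_of_nonneg_left hs hu
  linarith

/-- An involution that preserves blocks and the coordinates from `k` on. -/
theorem exists_realizable_of_involution (ν k : ℕ) (hk : k ≤ ν) :
    ∃ C : ℝ, 0 ≤ C ∧ ∀ (N s j m : ℕ) (σ : CubePerm ν N), (∀ κ, σ (σ κ) = κ) →
      (∀ κ i, blk s j (σ κ i) = blk s j (κ i)) →
      (∀ κ (i : Fin ν), k ≤ (i : ℕ) → σ κ i = κ i) → σ.support.card ≤ m →
      Realizable σ (C * ((2 ^ j - 1) * (N : ℝ) ^ (-1 - (ν : ℝ) / 2) * √(m : ℝ))) := by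
  classical
  induction k with
  | zero =>
    refine ⟨0, le_rfl, fun N s j m σ _ _ h _ => ?_⟩
    have : σ = 1 := Equiv.ext fun κ => funext fun i => h κ i (Nat.zero_le _)
    rw [this]
    exact Realizable.one (by simp)
  | succ k ih =>
    obtain ⟨C, hC, ih⟩ := ih (by omega)
    -- The 2 pays for the pairs inside a single segment, each `8 + C` for one batch of the others.
    refine ⟨2 + (8 + C) + (8 + C), by linarith, fun N s j m σ hσ hblk hfix hm => ?_⟩
    let d : Fin ν := ⟨k, hk⟩
    set U := (2 ^ j - 1) * (N : ℝ) ^ (-1 - (ν : ℝ) / 2) * √(m : ℝ) with hU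
    obtain ⟨c, hcσ, hcblk, hc⟩ := exists_coloring d s j σ hσ (fun κ => hblk κ d)
    let L : Cell ν N → Prop := fun κ => segment d s j (σ κ) = segment d s j κ
    have hL : ∀ κ, L (σ κ) ↔ L κ := fun κ => by
      simp only [L, hσ]; exact eq_comm
    have hbatch : ∀ β : Bool, ∃ τ : CubePerm ν N,
        (∀ κ, (¬ L κ ∧ (c κ).1 = β) → τ κ = σ κ) ∧
        (∀ κ, ¬ (¬ L κ ∧ (c κ).1 = β) → τ κ = κ) ∧ Realizable τ ((8 + C) * U) := by
      intro β
      have hp : ∀ κ, (¬ L (σ κ) ∧ (c (σ κ)).1 = β) ↔ (¬ L κ ∧ (c κ).1 = β) := fun κ => by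
        rw [hL, hcσ]
      obtain ⟨τ, hτ, hτ1, hτ2⟩ := exists_involution_restrict σ hσ
        (fun κ => ¬ L κ ∧ (c κ).1 = β) hp
      refine ⟨τ, hτ1, hτ2, ?_⟩
      have hor : ∀ κ, τ κ = σ κ ∨ τ κ = κ := fun κ => by
        by_cases h : ¬ L κ ∧ (c κ).1 = β
        · exact Or.inl (hτ1 κ h)
        · exact Or.inr (hτ2 κ h)
      have := realizable_of_batch d s j τ (m := m) (c := C * U) hτ
        (fun κ i => by rcases hor κ with h | h <;> rw [h]; exact hblk κ i)
        (Finset.univ.filter fun κ => ¬ L κ ∧ (c κ).1 = β)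
        ((Finset.card_le_card fun κ hκ => by
          rw [Equiv.Perm.mem_support]
          intro h
          simp [L, h] at hκ).trans hm)
        (fun κ hκ => hτ2 κ (by simpa using hκ))
        (fun κ hκ => by
          rw [Finset.mem_filter] at hκ ⊢
          rw [hτ1 κ hκ.2]
          exact ⟨Finset.mem_univ _, (hp κ).2 hκ.2⟩)
        (fun κ => (c κ).2)
        (fun κ hκ => by rw [hτ1 κ (Finset.mem_filter.1 hκ).2, hcσ])
        (fun κ _ => hcblk κ)
        (fun κ hκ κ' hκ' h1 h2 => by
          rw [Finset.mem_filter] at hκ hκ'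
          by_contra hne
          exact hc κ κ' hne h1 hκ.2.1 (Prod.ext (hκ.2.2.trans hκ'.2.2.symm) h2))
        (fun τ' h1 h2 h3 h4 h5 => ih N s j m τ' h1 h2
          (fun κ i hi => by
            by_cases hid : i = d
            · rw [hid, h3]
            · refine h4 i hid (fun κ => ?_) κ
              have : k + 1 ≤ (i : ℕ) := by
                have : (i : ℕ) ≠ k := fun h => hid (Fin.ext h)
                omega
              rcases hor κ with h | h <;> rw [h]
              exact hfix κ i this) h5)
      refine this.mono (le_of_eq ?_)
      ring
    obtain ⟨τ₀, hτ₀, h₀, h₀'⟩ := exists_involution_restrict σ hσ L hL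
    obtain ⟨τ₁, h₁, h₁', hR₁⟩ := hbatch true
    obtain ⟨τ₂, h₂, h₂', hR₂⟩ := hbatch false
    have hR₀ : Realizable τ₀ (2 * U) := by
      have := realizable_of_segment d s j τ₀ (m := m)
        (fun κ => by
          by_cases h : L κ
          · rw [h₀ κ h]; exact h
          · rw [h₀' κ h])
        ((Finset.card_le_card fun κ hκ => by
          rw [Equiv.Perm.mem_support] at hκ ⊢
          intro h
          by_cases hκL : L κ
          · exact hκ (by rw [h₀ κ hκL, h])
          · exact hκ (h₀' κ hκL)).trans hm)
      refine this.mono (le_of_eq ?_)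
      rw [hU]; ring
    have heq : σ = τ₀ * (τ₁ * τ₂) := by
      refine Equiv.ext fun κ => ?_
      rw [Equiv.Perm.mul_apply, Equiv.Perm.mul_apply]
      by_cases hκ : L κ
      · rw [h₂' κ (fun h => h.1 hκ), h₁' κ (fun h => h.1 hκ), h₀ κ hκ]
      · cases hβ : (c κ).1
        · rw [h₂ κ ⟨hκ, hβ⟩, h₁' _ (fun h => by rw [hcσ, hβ] at h; simp at h),
            h₀' _ (by rwa [hL])]
        · rw [h₂' κ (fun h => by rw [hβ] at h; simp at h), h₁ κ ⟨hκ, hβ⟩, h₀' _ (by rwa [hL])]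
    rw [heq]
    refine (hR₀.mul (hR₁.mul hR₂)).mono (le_of_eq ?_)
    ring

/-- A permutation that preserves blocks of side `2 ^ j` is reached at a cost proportional to
`2 ^ j - 1` and to the square root of the number of subcubes that it moves. -/
theorem exists_realizable_of_blk (ν : ℕ) :
    ∃ C : ℝ, 0 ≤ C ∧ ∀ (N s j m : ℕ) (σ : CubePerm ν N),
      (∀ κ i, blk s j (σ κ i) = blk s j (κ i)) → σ.support.card ≤ m →
      Realizable σ (C * ((2 ^ j - 1) * (N : ℝ) ^ (-1 - (ν : ℝ) / 2) * √(m : ℝ))) := by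
  obtain ⟨C, hC, h⟩ := exists_realizable_of_involution ν ν le_rfl
  refine ⟨C + C, by linarith, fun N s j m σ hblk hm => ?_⟩
  obtain ⟨a, b, hab, ha, hb, hac, hbc⟩ := exists_involutions_mul_eq σ
  -- Each factor sends a point to another point of its `σ`-cycle, so it inherits the invariant
  -- blocks and the fixed points of `σ`.
  have hpow : ∀ (n : ℤ) κ i, blk s j ((σ ^ n) κ i) = blk s j (κ i) := by
    intro n
    induction n using Int.induction_on with
    | zero => simp
    | succ n ih => intro κ i; rw [zpow_add_one, Equiv.Perm.mul_apply, ih, hblk]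
    | pred n ih =>
      intro κ i
      rw [zpow_sub_one, Equiv.Perm.mul_apply, ih, ← hblk (σ⁻¹ κ)]
      simp
  have key : ∀ τ : CubePerm ν N, (∀ κ, τ (τ κ) = κ) → (∀ κ, σ.SameCycle κ (τ κ)) →
      Realizable τ (C * ((2 ^ j - 1) * (N : ℝ) ^ (-1 - (ν : ℝ) / 2) * √(m : ℝ))) := by
    intro τ hτ hcyc
    refine h N s j m τ hτ (fun κ i => ?_) (fun κ i hi => absurd i.isLt (not_lt.2 hi))
      ((Finset.card_le_card fun κ hκ => ?_).trans hm)
    · obtain ⟨n, hn⟩ := hcyc κ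
      rw [← hn, hpow]
    · rw [Equiv.Perm.mem_support] at hκ ⊢
      intro hfix
      exact hκ ((hcyc κ).eq_of_left hfix).symm
  rw [hab, add_mul]
  exact (key a ha hac).mul (key b hb hbc)

/-! ### The `L²` distance -/

/-- The sum of the squared displacements of the subcubes, in units of the side of a subcube. -/
def sqDisplacement (σ : CubePerm ν N) : ℝ :=
  ∑ κ, ∑ i, (((σ κ i : ℕ) : ℝ) - ((κ i : ℕ) : ℝ)) ^ 2

theorem measurableSet_openCube (κ : Cell ν N) : MeasurableSet (openCube κ) := by
  simp only [openCube, Set.ofPred_forall]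
  refine MeasurableSet.iInter fun k => ?_
  have hk : Measurable fun x : EuclideanSpace ℝ (Fin ν) => x k := by fun_prop
  exact (measurableSet_lt measurable_const hk).inter (measurableSet_lt hk measurable_const)

theorem volume_openCube (κ : Cell ν N) :
    MeasureTheory.volume (openCube κ) = ENNReal.ofReal ((1 / (N : ℝ)) ^ ν) := by
  have h : openCube κ = (WithLp.ofLp : EuclideanSpace ℝ (Fin ν) → (Fin ν → ℝ)) ⁻¹'
      (Set.pi Set.univ fun i =>
        Set.Ioo (((κ i : ℕ) : ℝ) / N) ((((κ i : ℕ) : ℝ) + 1) / N)) := by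
    ext x
    simp [openCube]
  rw [h, (PiLp.volume_preserving_ofLp (Fin ν)).measure_preimage
    (MeasurableSet.univ_pi fun i => measurableSet_Ioo).nullMeasurableSet, Real.volume_pi_Ioo]
  have h1 : ∀ i, (((κ i : ℕ) : ℝ) + 1) / N - ((κ i : ℕ) : ℝ) / N = 1 / (N : ℝ) := fun i => by ring
  simp only [h1, Finset.prod_const, Finset.card_univ, Fintype.card_fin]
  rw [ENNReal.ofReal_pow (by positivity)]

theorem openCube_subset_unitCube (κ : Cell ν N) : openCube κ ⊆ unitCube ν := by
  intro x hx k
  have hN : (0 : ℝ) < N := by exact_mod_cast (κ k).pos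
  obtain ⟨h1, h2⟩ := hx k
  have h3 : (((κ k : ℕ) : ℝ) + 1) / N ≤ 1 := by
    rw [div_le_one hN]
    exact_mod_cast (κ k).isLt
  have h4 : (0 : ℝ) ≤ ((κ k : ℕ) : ℝ) / N := by positivity
  exact ⟨by linarith, by linarith⟩

theorem norm_center_sub_sq (κ κ' : Cell ν N) :
    ‖center κ - center κ'‖ ^ 2 =
      (1 / (N : ℝ)) ^ 2 * ∑ i, (((κ i : ℕ) : ℝ) - ((κ' i : ℕ) : ℝ)) ^ 2 := by
  rw [EuclideanSpace.norm_sq_eq, Finset.mul_sum]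
  refine Finset.sum_congr rfl fun i _ => ?_
  simp only [center, PiLp.sub_apply, Real.norm_eq_abs, sq_abs]
  ring

theorem sqDisplacement_mul_inv (P Q : CubePerm ν N) :
    sqDisplacement (Q * P⁻¹) =
      ∑ κ, ∑ i, (((Q κ i : ℕ) : ℝ) - ((P κ i : ℕ) : ℝ)) ^ 2 := by
  unfold sqDisplacement
  rw [← Equiv.sum_comp P]
  simp

/-- Only this inequality is needed, so it suffices to integrate over the disjoint open subcubes, on
each of which the difference is constant. -/
theorem ofReal_le_l2Dist (hN : 1 ≤ N) (P Q : CubePerm ν N) :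
    ENNReal.ofReal ((N : ℝ) ^ (-1 - (ν : ℝ) / 2) * √(sqDisplacement (Q * P⁻¹))) ≤
      l2Dist P Q := by
  classical
  have hN0 : (0 : ℝ) < N := by exact_mod_cast hN
  have hS : 0 ≤ sqDisplacement (Q * P⁻¹) :=
    Finset.sum_nonneg fun _ _ => Finset.sum_nonneg fun _ _ => sq_nonneg _
  unfold l2Dist
  rw [MeasureTheory.eLpNorm_eq_lintegral_rpow_enorm_toReal (by norm_num) (by norm_num)]
  have hcube : ∀ κ : Cell ν N,
      ∫⁻ x in openCube κ, ‖toMap P x - toMap Q x‖ₑ ^ (2 : ℝ≥0∞).toReal =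
        ENNReal.ofReal ((1 / (N : ℝ)) ^ 2 * (1 / (N : ℝ)) ^ ν *
          ∑ i, (((Q κ i : ℕ) : ℝ) - ((P κ i : ℕ) : ℝ)) ^ 2) := by
    intro κ
    have : Set.EqOn (fun x => ‖toMap P x - toMap Q x‖ₑ ^ (2 : ℝ≥0∞).toReal)
        (fun _ => ENNReal.ofReal (‖center (Q κ) - center (P κ)‖ ^ 2)) (openCube κ) := by
      intro x hx
      simp only
      rw [toMap_of_mem P hx, toMap_of_mem Q hx,
        show x + (center (P κ) - center κ) - (x + (center (Q κ) - center κ)) =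
          -(center (Q κ) - center (P κ)) by abel, enorm_neg, ENNReal.toReal_ofNat,
        ENNReal.rpow_ofNat, ← ofReal_norm, ENNReal.ofReal_pow (norm_nonneg _)]
    rw [MeasureTheory.setLIntegral_congr_fun (measurableSet_openCube κ) this,
      MeasureTheory.setLIntegral_const, volume_openCube, ← ENNReal.ofReal_mul (by positivity),
      norm_center_sub_sq]
    congr 1
    ring
  have hint : ENNReal.ofReal ((1 / (N : ℝ)) ^ 2 * (1 / (N : ℝ)) ^ ν *
      sqDisplacement (Q * P⁻¹)) ≤
      ∫⁻ x in unitCube ν, ‖toMap P x - toMap Q x‖ₑ ^ (2 : ℝ≥0∞).toReal := by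
    rw [sqDisplacement_mul_inv, Finset.mul_sum, ENNReal.ofReal_sum_of_nonneg (fun κ _ =>
      mul_nonneg (by positivity) (Finset.sum_nonneg fun _ _ => sq_nonneg _)),
      ← Finset.sum_congr rfl fun κ _ => hcube κ,
      ← MeasureTheory.lintegral_biUnion_finset]
    · exact MeasureTheory.lintegral_mono_set
        (Set.iUnion₂_subset fun κ _ => openCube_subset_unitCube κ)
    · intro κ _ κ' _ hne
      exact Set.disjoint_left.2 fun x hx hx' => hne (openCube_unique hx hx')
    · exact fun κ _ => measurableSet_openCube κ
  refine le_trans (le_of_eq ?_) (ENNReal.rpow_le_rpow hint (by norm_num))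
  rw [ENNReal.toReal_ofNat, ENNReal.ofReal_rpow_of_nonneg (by positivity) (by norm_num)]
  congr 1
  rw [← Real.sqrt_eq_rpow, Real.sqrt_mul (by positivity)]
  congr 1
  rw [eq_comm, Real.sqrt_eq_iff_mul_self_eq (by positivity) (by positivity), ← Real.rpow_add hN0,
    ← pow_add, one_div, inv_pow, ← Real.rpow_natCast, ← Real.rpow_neg hN0.le]
  congr 1
  push_cast
  ring

/-! ### Choice of the blocks -/

/-- The quotients differ only if `n` divides one of the `d` integers after `a + s`; each of these is
a multiple of `n` for at most one `s < n`. -/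
theorem card_div_ne_le (n a d : ℕ) :
    ((Finset.range n).filter fun s => (a + s) / n ≠ (a + d + s) / n).card ≤ d := by
  induction d with
  | zero => simp
  | succ d ih =>
    have hone : ((Finset.range n).filter fun s => n ∣ a + d + s + 1).card ≤ 1 := by
      rw [Finset.card_le_one]
      intro s hs s' hs'
      simp only [Finset.mem_filter, Finset.mem_range] at hs hs'
      have h : s ≡ s' [MOD n] := by
        have := ((Nat.modEq_zero_iff_dvd.2 hs.2).trans (Nat.modEq_zero_iff_dvd.2 hs'.2).symm)
        rw [show a + d + s + 1 = (a + d + 1) + s by ring,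
          show a + d + s' + 1 = (a + d + 1) + s' by ring] at this
        exact Nat.ModEq.add_left_cancel' _ this
      exact h.eq_of_lt_of_lt hs.1 hs'.1
    have hsub : ((Finset.range n).filter fun s => (a + s) / n ≠ (a + (d + 1) + s) / n) ⊆
        ((Finset.range n).filter fun s => (a + s) / n ≠ (a + d + s) / n) ∪
          (Finset.range n).filter fun s => n ∣ a + d + s + 1 := by
      intro s hs
      simp only [Finset.mem_union, Finset.mem_filter] at hs ⊢
      by_cases h : n ∣ a + d + s + 1
      · exact Or.inr ⟨hs.1, h⟩
      · refine Or.inl ⟨hs.1, fun heq => hs.2 ?_⟩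
        rw [heq, show a + (d + 1) + s = a + d + s + 1 by ring, Nat.succ_div, if_neg h]
        rfl
    have h1 := Finset.card_le_card hsub
    have h2 := Finset.card_union_le
      ((Finset.range n).filter fun s => (a + s) / n ≠ (a + d + s) / n)
      ((Finset.range n).filter fun s => n ∣ a + d + s + 1)
    omega

/-- Few shifts separate two given positions by the boundary of a block. -/
theorem card_blk_ne_le (j : ℕ) (t u : Fin N) :
    ((Finset.range (2 ^ j)).filter fun s => blk s j t ≠ blk s j u).card ≤
      ((t : ℤ) - (u : ℤ)).natAbs := by
  rcases le_total (t : ℕ) u with h | h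
  · obtain ⟨d, hd⟩ := Nat.exists_eq_add_of_le h
    have := card_div_ne_le (2 ^ j) t d
    simp only [blk, hd]
    refine this.trans ?_
    omega
  · obtain ⟨d, hd⟩ := Nat.exists_eq_add_of_le h
    have := card_div_ne_le (2 ^ j) u d
    simp only [blk, hd, ne_comm (a := ((u : ℕ) + d + _) / 2 ^ j)]
    refine this.trans ?_
    omega

/-- The subcubes that `σ` moves to another block. -/
def crossing (σ : CubePerm ν N) (s j : ℕ) : Finset (Cell ν N) :=
  Finset.univ.filter fun κ => ∃ i, blk s j (σ κ i) ≠ blk s j (κ i)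

/-- Averaging: over the `2 ^ j` shifts, a displacement by `d` along a coordinate crosses a boundary
at most `d` times. -/
theorem exists_shift (σ : CubePerm ν N) (j : ℕ) :
    ∃ s, 2 ^ j * (crossing σ s j).card ≤
      ∑ κ, ∑ i, (((σ κ i : ℕ) : ℤ) - ((κ i : ℕ) : ℤ)).natAbs := by
  classical
  set T := ∑ κ, ∑ i, (((σ κ i : ℕ) : ℤ) - ((κ i : ℕ) : ℤ)).natAbs
  have hsum : ∑ s ∈ Finset.range (2 ^ j), (crossing σ s j).card ≤ T := by
    have h1 : ∀ s, (crossing σ s j).card ≤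
        ∑ κ, ∑ i, if blk s j (σ κ i) ≠ blk s j (κ i) then 1 else 0 := by
      intro s
      rw [crossing, Finset.card_filter]
      refine Finset.sum_le_sum fun κ _ => ?_
      split_ifs with h
      · obtain ⟨i, hi⟩ := h
        exact (by simp [hi] : 1 ≤ if blk s j (σ κ i) ≠ blk s j (κ i) then 1 else 0).trans
          (Finset.single_le_sum
            (f := fun i => if blk s j (σ κ i) ≠ blk s j (κ i) then 1 else 0)
            (fun _ _ => Nat.zero_le _) (Finset.mem_univ i))
      · exact Nat.zero_le _
    refine (Finset.sum_le_sum fun s _ => h1 s).trans ?_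
    rw [Finset.sum_comm]
    refine Finset.sum_le_sum fun κ _ => ?_
    rw [Finset.sum_comm]
    refine Finset.sum_le_sum fun i _ => ?_
    rw [← Finset.card_filter]
    exact card_blk_ne_le j (σ κ i) (κ i)
  obtain ⟨s, -, hs⟩ := Finset.exists_le_of_sum_le (s := Finset.range (2 ^ j))
    (f := fun s => 2 ^ j * (crossing σ s j).card) (g := fun _ => T) (by simp) (by
      rw [← Finset.mul_sum, Finset.sum_const, Finset.card_range, smul_eq_mul]
      exact Nat.mul_le_mul_left _ hsum)
  exact ⟨s, hs⟩

/-- Cauchy–Schwarz over the `ν * N ^ ν` pairs of a subcube and a coordinate. -/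
theorem sq_sum_natAbs_le (σ : CubePerm ν N) :
    ((∑ κ, ∑ i, (((σ κ i : ℕ) : ℤ) - ((κ i : ℕ) : ℤ)).natAbs : ℕ) : ℝ) ^ 2 ≤
      ν * (N : ℝ) ^ ν * sqDisplacement σ := by
  have h := sq_sum_le_card_mul_sum_sq (s := (Finset.univ : Finset (Cell ν N × Fin ν)))
    (f := fun x => |((σ x.1 x.2 : ℕ) : ℝ) - ((x.1 x.2 : ℕ) : ℝ)|)
  simp only [sq_abs, Fintype.sum_prod_type, Finset.card_univ, Fintype.card_prod,
    Fintype.card_pi, Fintype.card_fin, Finset.prod_const] at h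
  simp only [sqDisplacement]
  push_cast [Nat.cast_natAbs] at h ⊢
  linarith

/-- A permutation splits into a permutation inside the blocks and a permutation that moves only
the subcubes that change block. -/
theorem exists_factorization (σ : CubePerm ν N) (s j : ℕ) :
    ∃ ρ τ : CubePerm ν N, σ = ρ * τ ∧ (∀ κ i, blk s j (ρ κ i) = blk s j (κ i)) ∧
      τ.support ⊆ crossing σ s j := by
  classical
  -- `ψ` undoes `σ` on the images of the subcubes that stay in their block, so `ψ * σ` fixes those
  -- subcubes.
  obtain ⟨ψ, h1, h2, -⟩ := exists_perm_extending (fun (κ : Cell ν N) i => blk s j (κ i))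
    (fun κ => σ⁻¹ κ) (Finset.univ.filter fun κ => σ⁻¹ κ ∉ crossing σ s j)
    (σ⁻¹.injective.injOn) (fun κ hκ => by
      simp only [crossing, Finset.mem_filter, Finset.mem_univ, true_and, not_exists, not_not,
        Equiv.Perm.coe_inv, Equiv.apply_symm_apply] at hκ
      funext i
      exact (hκ i).symm)
  refine ⟨ψ⁻¹, ψ * σ, by group, fun κ i => ?_, fun κ hκ => ?_⟩
  · have := congrFun (h2 (ψ⁻¹ κ)) i
    simpa using this.symm
  · by_contra h
    refine Equiv.Perm.mem_support.1 hκ ?_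
    rw [Equiv.Perm.mul_apply, h1 _ (by simpa using h)]
    simp

/-! ### The discrete inequality -/

/-- The `- 1` covers `x < 1`: blocks are then single subcubes and cost nothing, whereas `2 ^ j ≤ 2 *
x` may fail. -/
theorem exists_two_pow_ge {x : ℝ} (hx : 0 ≤ x) :
    ∃ j : ℕ, x ≤ 2 ^ j ∧ (2 : ℝ) ^ j - 1 ≤ 2 * x := by
  rcases le_total x 1 with h | h
  · exact ⟨0, by simpa using h, by simpa using hx⟩
  · obtain ⟨n, h1, h2⟩ := exists_nat_pow_near h (one_lt_two : (1 : ℝ) < 2)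
    refine ⟨n + 1, h2.le, ?_⟩
    rw [pow_succ]
    linarith

theorem eq_one_of_sqDisplacement_eq_zero {σ : CubePerm ν N} (h : sqDisplacement σ = 0) :
    σ = 1 := by
  have h0 : ∀ κ, 0 ≤ ∑ i, (((σ κ i : ℕ) : ℝ) - ((κ i : ℕ) : ℝ)) ^ 2 := fun κ =>
    Finset.sum_nonneg fun _ _ => sq_nonneg _
  refine Equiv.ext fun κ => funext fun i => ?_
  have h1 := (Finset.sum_eq_zero_iff_of_nonneg fun κ _ => h0 κ).1 h κ (Finset.mem_univ _)
  have h2 := (Finset.sum_eq_zero_iff_of_nonneg fun _ _ => sq_nonneg _).1 h1 i (Finset.mem_univ _)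
  have h3 := sub_eq_zero.1 (pow_eq_zero_iff (two_ne_zero)|>.1 h2)
  exact Fin.ext (by exact_mod_cast h3)

theorem exists_realizable_rpow (ν : ℕ) :
    ∃ C : ℝ, 0 < C ∧ ∀ N : ℕ, 1 ≤ N → ∀ σ : CubePerm ν N,
      Realizable σ
        (C * ((N : ℝ) ^ (-1 - (ν : ℝ) / 2) * √(sqDisplacement σ)) ^ (1 / 3 : ℝ)) := by
  obtain ⟨C, hC, hR⟩ := exists_realizable_of_blk ν
  refine ⟨2 * C * (ν + 1) + 1, by positivity, fun N hN σ => ?_⟩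
  have hN0 : (0 : ℝ) < N := by exact_mod_cast hN
  have hS : 0 ≤ sqDisplacement σ :=
    Finset.sum_nonneg fun _ _ => Finset.sum_nonneg fun _ _ => sq_nonneg _
  rcases hS.eq_or_lt with h0 | hS
  · rw [eq_one_of_sqDisplacement_eq_zero h0.symm]
    exact Realizable.one (by positivity)
  set w : ℝ := (N : ℝ) ^ (-1 - (ν : ℝ) / 2) with hw
  set r : ℝ := √((N : ℝ) ^ ν) with hr
  have hw0 : 0 < w := Real.rpow_pos_of_pos hN0 _
  have hr0 : 0 < r := Real.sqrt_pos.2 (by positivity)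
  have hr2 : r ^ 2 = (N : ℝ) ^ ν := Real.sq_sqrt (by positivity)
  -- Normalisation: moving all `N ^ ν` subcubes across the whole cube costs a constant.
  have hwr : w * (N * r) = 1 := by
    have h1 : r = (N : ℝ) ^ ((ν : ℝ) / 2) := by
      rw [hr, Real.sqrt_eq_rpow, ← Real.rpow_natCast, ← Real.rpow_mul hN0.le]
      congr 1
      ring
    rw [h1, hw, ← Real.rpow_one_add' hN0.le (by positivity), ← Real.rpow_add hN0]
    ring_nf
    exact Real.rpow_zero _
  set D := w * √(sqDisplacement σ) with hD
  have hD0 : 0 < D := mul_pos hw0 (Real.sqrt_pos.2 hS)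
  set y := D ^ (1 / 3 : ℝ) with hy
  have hy0 : 0 < y := Real.rpow_pos_of_pos hD0 _
  have hy3 : y ^ 3 = D := by
    rw [hy, ← Real.rpow_natCast, ← Real.rpow_mul hD0.le]
    norm_num
  have hν2 : (ν : ℝ) ≤ (ν : ℝ) ^ 2 := by exact_mod_cast Nat.le_self_pow two_ne_zero ν
  -- Side `y * N` balances the two costs; generation `J` has blocks large enough to contain the
  -- whole cube.
  obtain ⟨j, hj1, hj2⟩ := exists_two_pow_ge (x := y * N) (by positivity)
  obtain ⟨J, hJ1, hJ2⟩ := exists_two_pow_ge (x := (N : ℝ)) hN0.le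
  obtain ⟨s, hs⟩ := exists_shift σ j
  set M := (crossing σ s j).card
  set T := ∑ κ, ∑ i, (((σ κ i : ℕ) : ℤ) - ((κ i : ℕ) : ℤ)).natAbs
  have hT : (T : ℝ) ≤ ν * N * r ^ 2 * y ^ 3 := by
    -- The factor `ν` is enlarged to `ν ^ 2` below, here and for `M`, only to avoid `√ν`.
    have h1 : (T : ℝ) ^ 2 ≤ ν * (N : ℝ) ^ ν * sqDisplacement σ := sq_sum_natAbs_le σ
    have h2 : √(sqDisplacement σ) = N * r * D := by
      rw [hD, ← mul_assoc, mul_comm _ w, hwr, one_mul]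
    have h3 : sqDisplacement σ = (N * r * D) ^ 2 := by rw [← h2, Real.sq_sqrt hS.le]
    refine le_of_sq_le_sq ?_ (by positivity)
    calc (T : ℝ) ^ 2 ≤ ν * (r ^ 2 * (N * r * D) ^ 2) := by
          rw [hr2, ← h3]; linarith
      _ ≤ (ν : ℝ) ^ 2 * (r ^ 2 * (N * r * D) ^ 2) := by gcongr
      _ = (ν * N * r ^ 2 * y ^ 3) ^ 2 := by rw [hy3]; ring
  have hM : √(M : ℝ) ≤ ν * r * y := by
    have h1 : (2 : ℝ) ^ j * M ≤ T := by exact_mod_cast hs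
    have h2 : y * N * M ≤ y * N * (ν * (r * y) ^ 2) :=
      calc y * N * M ≤ 2 ^ j * M := by gcongr
        _ ≤ ν * N * r ^ 2 * y ^ 3 := h1.trans hT
        _ = y * N * (ν * (r * y) ^ 2) := by ring
    have h3 : (M : ℝ) ≤ ν * (r * y) ^ 2 := le_of_mul_le_mul_left h2 (by positivity)
    rw [Real.sqrt_le_left (by positivity)]
    calc (M : ℝ) ≤ ν * (r * y) ^ 2 := h3
      _ ≤ (ν : ℝ) ^ 2 * (r * y) ^ 2 := by gcongr
      _ = (ν * r * y) ^ 2 := by ring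
  obtain ⟨ρ, τ, hρτ, hρ, hτ⟩ := exists_factorization σ s j
  have hRρ := hR N s j (N ^ ν) ρ hρ (by
    simpa [Fintype.card_pi] using Finset.card_le_univ ρ.support)
  have hblk : ∀ t : Fin N, blk 0 J t = 0 := fun t => by
    have h1 : N ≤ 2 ^ J := by exact_mod_cast hJ1
    exact Nat.div_eq_of_lt (t.isLt.trans_le h1)
  have hRτ := hR N 0 J M τ (fun κ i => by rw [hblk, hblk]) (Finset.card_le_card hτ)
  rw [hρτ]
  refine (hRρ.mul hRτ).mono ?_
  rw [Nat.cast_pow, ← hw, ← hr]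
  have e1 : (2 ^ j - 1) * w * r ≤ 2 * y :=
    calc (2 ^ j - 1) * w * r ≤ 2 * (y * N) * w * r := by gcongr
      _ = 2 * y * (w * (N * r)) := by ring
      _ = 2 * y := by rw [hwr, mul_one]
  have e2 : (2 ^ J - 1) * w * √(M : ℝ) ≤ 2 * ν * y :=
    calc (2 ^ J - 1) * w * √(M : ℝ) ≤ 2 * N * w * (ν * r * y) := by gcongr
      _ = 2 * ν * y * (w * (N * r)) := by ring
      _ = 2 * ν * y := by rw [hwr, mul_one]
  have e3 := mul_le_mul_of_nonneg_left (add_le_add e1 e2) hC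
  linarith

theorem exists_discreteDist_le (ν : ℕ) :
    ∃ C : ℝ, 0 < C ∧ ∀ N : ℕ, 1 ≤ N → ∀ P Q : CubePerm ν N,
      discreteDist P Q ≤ ENNReal.ofReal C * l2Dist P Q ^ (1 / 3 : ℝ) := by
  obtain ⟨C, hC, hR⟩ := exists_realizable_rpow ν
  refine ⟨C, hC, fun N hN P Q => (discreteDist_le (hR N hN (Q * P⁻¹))).trans ?_⟩
  rw [ENNReal.ofReal_mul hC.le, ← ENNReal.ofReal_rpow_of_nonneg (by positivity) (by norm_num)]
  gcongr
  exact ofReal_le_l2Dist hN P Q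

end Shnirelman

end

theorem mainTheorem1 :
    (∀ ν : ℕ, 3 ≤ ν → ∃ C : ℝ, 0 < C ∧ ∃ α : ℝ, 1 / (1 + (ν : ℝ)) ≤ α ∧
      ∀ N : ℕ, 1 ≤ N → ∀ P Q : Shnirelman.CubePerm ν N,
        Shnirelman.discreteDist P Q ≤ ENNReal.ofReal C * Shnirelman.l2Dist P Q ^ α) ∧
    (∃ C : ℝ, 0 < C ∧ ∃ α : ℝ, 2 / 7 ≤ α ∧
      ∀ N : ℕ, 1 ≤ N → ∀ P Q : Shnirelman.CubePerm 2 N,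
        Shnirelman.discreteDist P Q ≤ ENNReal.ofReal C * Shnirelman.l2Dist P Q ^ α) := by
  refine ⟨fun ν hν => ?_, ?_⟩
  · obtain ⟨C, hC, h⟩ := Shnirelman.exists_discreteDist_le ν
    have hν' : (3 : ℝ) ≤ ν := by exact_mod_cast hν
    exact ⟨C, hC, 1 / 3, one_div_le_one_div_of_le (by norm_num) (by linarith), h⟩
  · obtain ⟨C, hC, h⟩ := Shnirelman.exists_discreteDist_le 2
    exact ⟨C, hC, 1 / 3, by norm_num, h⟩
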